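/- Let $(F_n)_{n\ge1}$ be distribution functions of probability laws on $[0,1]$ (non-decreasing, right-continuous, $F_n(1)=1$) with $F_n(0)=0$, and let $(\alpha_n)_{n\ge1}$ be positive reals such that (i) $0<\liminf_n\alpha_n\le\limsup_n\alpha_n<\infty$ and $\lim_{t\to0^+}\sup_{n\ge1}\left|\frac{F_n(t)}{t}-\alpha_n\right|=0$; (ii) $\lim_{t\to0^+}\sup_{n\ge1}\int_0^t\frac1u\left|\frac{F_n(u)}{u}-\alpha_n\right|\,du=0$. *Oppenheim scheme.* Let $\varphi_n:\{1,2,\dots\}\to(0,\infty)$ be functions, let $q_n=q_n(h_1,\dots,h_n)\ge0$ be functions of $n$ integers, and put $$\delta_n(h,k,q)=\frac{\varphi_n(h)(1+q)}{k+\varphi_n(h)\,q}.$$ Let $(\Theta_n)_{n\ge1}$ be integer-valued random variables on a probability space $(\Omega,\mathcal A,P)$ with $\Theta_1\ge1$ and $\Theta_{n+1}\ge\varphi_n(\Theta_n)$ almost surely for every $n\ge1$, such that for all $n\ge1$ and all integers $h_1,\dots,h_{n+1}$ with $h_1\ge1$, $h_{j+1}\ge\varphi_j(h_j)$ for $1\le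 j\le n$, and $P(\Theta_1=h_1,\dots,\Theta_n=h_n)>0$, $$P(\Theta_{n+1}=h_{n+1}\mid\Theta_n=h_n,\dots,\Theta_1=h_1)=F_n\big(\delta_n(h_n,h_{n+1},q_n)\big)-F_n\big(\delta_n(h_n,h_{n+1}+1,q_n)\big),$$ where $q_n=q_n(h_1,\dots,h_n)$. Put $Q_n=q_n(\Theta_1,\dots,\Theta_n)$ and $$R_n=\frac{\Theta_{n+1}+\varphi_n(\Theta_n)Q_n}{\varphi_n(\Theta_n)(1+Q_n)}=\frac1{\delta_n(\Theta_n,\Theta_{n+1},Q_n)}.$$ *Weights.* Let $(a_{k,n})_{1\le k\le n}$ be an array of positive numbers and $(\rho_n)_{n\ge1}$ a real sequence with $\rho_n\log n\to+\infty$, such that $$\limsup_{n\to\infty}\frac{\sum_{k=1}^n\alpha_ka_{k,n}|\log(\alpha_ka_{k,n})|}{\rho_n\log n}<\infty,\qquad \lim_{n\to\infty}\frac{\sum_{k=1}^n\alpha_ka_{k,n}\log(\alpha_ka_{k,n})}{\rho_n\log n}=:-\ell\ \text{ exists},$$ and the sequence $n\mapsto\sum_{k=1}^n\alpha_ka_{k,n}$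 is bounded. Then $$\frac1{\rho_n\log n}\sum_{k=1}^na_{k,n}R_k\longrightarrow\ell\quad\text{in probability as }n\to\infty.$$ -/

import Mathlib

open MeasureTheory ProbabilityTheory Filter Topology Set

noncomputable section

namespace Oppenheim

/-- Distribution functions of probability laws on `[0,1]` that vanish at `0`. -/
structure IsDistributionFunction (F : ℝ → ℝ) : Prop where
  mono : Monotone F
  right_continuous : ∀ x, ContinuousWithinAt F (Ici x) x
  eq_zero : ∀ x ≤ 0, F x = 0
  eq_one : ∀ x, 1 ≤ x → F x = 1

/-- Condition (i). Sequences start at index `1`; the suprema, limits inferior and limits superior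
are taken in the extended reals, so that they always have their true value. -/
structure ConditionI (F : ℕ → ℝ → ℝ) (α : ℕ → ℝ) : Prop where
  pos : ∀ n, 1 ≤ n → 0 < α n
  liminf_pos : (0 : EReal) < liminf (fun n => (α n : EReal)) atTop
  limsup_lt_top : limsup (fun n => (α n : EReal)) atTop < ⊤
  tendsto_sup : Tendsto (fun t : ℝ => ⨆ (n : ℕ) (_ : 1 ≤ n), ENNReal.ofReal |F n t / t - α n|)
    (𝓝[>] 0) (𝓝 0)

/-- Condition (ii), uniform integrability at `0` of `u ↦ (F n u / u - α n) / u`. -/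
def ConditionII (F : ℕ → ℝ → ℝ) (α : ℕ → ℝ) : Prop :=
  Tendsto (fun t : ℝ => ⨆ (n : ℕ) (_ : 1 ≤ n),
      ∫⁻ u in Ioo 0 t, ENNReal.ofReal ((1 / u) * |F n u / u - α n|))
    (𝓝[>] 0) (𝓝 0)

/-- `δ_j(h, k, q) = φ_j(h) (1 + q) / (k + φ_j(h) q)`. -/
def delta (φ : ℕ → ℕ → ℝ) (j h k : ℕ) (q : ℝ) : ℝ :=
  φ j h * (1 + q) / (k + φ j h * q)

/-- The tuple `(x_1, …, x_n)` of a sequence `x` indexed from `1`. -/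
def initial (n : ℕ) (x : ℕ → ℕ) : Fin n → ℕ := fun i => x (i + 1)

/-- The integer sequence `h` satisfies `h_1 ≥ 1` and `h_{j+1} ≥ φ_j(h_j)` for `1 ≤ j ≤ n`. -/
def Admissible (φ : ℕ → ℕ → ℝ) (n : ℕ) (h : ℕ → ℕ) : Prop :=
  1 ≤ h 1 ∧ ∀ j, 1 ≤ j → j ≤ n → φ j (h j) ≤ h (j + 1)

variable {Ω : Type*} [MeasurableSpace Ω]

/-- The event `{Θ_1 = h_1, …, Θ_n = h_n}`. -/
def history (Θ : ℕ → Ω → ℕ) (n : ℕ) (h : ℕ → ℕ) : Set Ω :=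
  {ω | ∀ j, 1 ≤ j → j ≤ n → Θ j ω = h j}

/-- The scheme that generates Oppenheim expansions: the random sequence `Θ_1, Θ_2, …` takes its
values in the admissible sequences of positive integers, and the conditional law of `Θ_{n+1}`
given `Θ_1, …, Θ_n` is driven by `F_n`. -/
structure IsScheme (P : Measure Ω) (F : ℕ → ℝ → ℝ) (φ : ℕ → ℕ → ℝ)
    (q : (n : ℕ) → (Fin n → ℕ) → ℝ) (Θ : ℕ → Ω → ℕ) : Prop where
  phi_pos : ∀ n, 1 ≤ n → ∀ h, 1 ≤ h → 0 < φ n h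
  q_nonneg : ∀ n, 1 ≤ n → ∀ h, 0 ≤ q n h
  measurable : ∀ n, 1 ≤ n → Measurable (Θ n)
  ae_one_le : ∀ᵐ ω ∂P, 1 ≤ Θ 1 ω
  ae_phi_le : ∀ n, 1 ≤ n → ∀ᵐ ω ∂P, φ n (Θ n ω) ≤ Θ (n + 1) ω
  cond_law : ∀ n, 1 ≤ n → ∀ h : ℕ → ℕ, Admissible φ n h → P (history Θ n h) ≠ 0 →
    (cond P (history Θ n h) {ω | Θ (n + 1) ω = h (n + 1)}).toReal =
      F n (delta φ n (h n) (h (n + 1)) (q n (initial n h))) -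
      F n (delta φ n (h n) (h (n + 1) + 1) (q n (initial n h)))

/-- `Q_n = q_n(Θ_1, …, Θ_n)`. -/
def Q (q : (n : ℕ) → (Fin n → ℕ) → ℝ) (Θ : ℕ → Ω → ℕ) (n : ℕ) (ω : Ω) : ℝ :=
  q n (initial n fun j => Θ j ω)

/-- `R_n = (Θ_{n+1} + φ_n(Θ_n) Q_n) / (φ_n(Θ_n) (1 + Q_n))`. -/
def R (φ : ℕ → ℕ → ℝ) (q : (n : ℕ) → (Fin n → ℕ) → ℝ) (Θ : ℕ → Ω → ℕ) (n : ℕ) (ω : Ω) : ℝ :=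
  (Θ (n + 1) ω + φ n (Θ n ω) * Q q Θ n ω) / (φ n (Θ n ω) * (1 + Q q Θ n ω))

end Oppenheim

end

/-! Conditionally on the past, `R_k` has tail close to `F_k(1/t)`, hence of order `α_k / t`: its
mean may be infinite, but its truncation at level `c` has conditional mean `α_k log c + O(1)`,
uniformly in `k`. The theorem is thus a weak law for heavy-tailed variables, proved by truncation
and martingale orthogonality.

Write `b = ρ_n log n`, `w_k = a_{k,n}`, and truncate `w_k R_k` at `b`. Since `α_k` is bounded below,
`∑ w_k` stays bounded. The tail bound `L / t` gives probability at most `L ∑ w_k / b → 0` that some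
truncation is effective. It also bounds the second moments of the truncated terms by `2 L b w_k`;
the centred terms are orthogonal, so their sum divided by `b` has second moment `O(1 / b)`. What
remains is the sum of compensators, `∑ α_k w_k log (b / w_k) + O(1)`, which equals `-∑ α_k w_k log
(α_k w_k) + O(1 + log b)`. Dividing by `b` leaves `ℓ`.

Two facts carry the reduction. Condition (ii), after `u = 1/y`, says that `F_n(1/y) - α_n / y` has
uniformly bounded integral at infinity (`exists_integral_comp_inv_bound`). And since `Θ_{n+1}` is an
integer, the conditional tail of `R_n` is only squeezed between `F_n(1/(t+L))` and `F_n(1/t)`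
(`measureReal_inter_R`); a bounded shift of `t` changes the logarithm by `O(1)`. -/

namespace Oppenheim

/-! ### Uniform consequences of conditions (i) and (ii) -/

section Analysis

variable {F : ℕ → ℝ → ℝ} {α : ℕ → ℝ}

lemma IsDistributionFunction.nonneg {G : ℝ → ℝ} (h : IsDistributionFunction G) (x : ℝ) :
    0 ≤ G x := by
  rcases le_total x 0 with hx | hx
  · exact (h.eq_zero x hx).ge
  · exact (h.eq_zero 0 le_rfl).ge.trans (h.mono hx)

lemma IsDistributionFunction.le_one {G : ℝ → ℝ} (h : IsDistributionFunction G) (x : ℝ) :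
    G x ≤ 1 := by
  rcases le_total x 1 with hx | hx
  · exact (h.mono hx).trans (h.eq_one 1 le_rfl).le
  · exact (h.eq_one x hx).le

lemma exists_pos_lower_bound {u : ℕ → ℝ} (hu : ∀ n, 1 ≤ n → 0 < u n) (N : ℕ) {m : ℝ}
    (hm : 0 < m) (hN : ∀ n, N ≤ n → m ≤ u n) : ∃ c, 0 < c ∧ ∀ n, 1 ≤ n → c ≤ u n := by
  have : ∀ k : ℕ, ∃ c, 0 < c ∧ ∀ n, 1 ≤ n → n ≤ k → c ≤ u n := by
    intro k
    induction k with
    | zero => exact ⟨1, one_pos, fun n h1 h2 => by omega⟩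
    | succ k ih =>
      obtain ⟨c, hc, h⟩ := ih
      refine ⟨min c (u (k + 1)), lt_min hc (hu _ (by omega)), fun n h1 h2 => ?_⟩
      rcases Nat.lt_or_ge k n with h3 | h3
      · obtain rfl : n = k + 1 := by omega
        exact min_le_right _ _
      · exact (min_le_left _ _).trans (h n h1 h3)
  obtain ⟨c, hc, h⟩ := this N
  refine ⟨min c m, lt_min hc hm, fun n hn => ?_⟩
  rcases le_total N n with h3 | h3
  · exact (min_le_right _ _).trans (hN n h3)
  · exact (min_le_left _ _).trans (h n hn h3)

lemma ConditionI.exists_lower_bound (hi : ConditionI F α) :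
    ∃ m, 0 < m ∧ ∀ n, 1 ≤ n → m ≤ α n := by
  obtain ⟨m, hm0, hm⟩ := EReal.lt_iff_exists_real_btwn.1 hi.liminf_pos
  obtain ⟨N, hN⟩ := eventually_atTop.1 (eventually_lt_of_lt_liminf hm)
  exact exists_pos_lower_bound hi.pos N (EReal.coe_pos.1 hm0)
    fun n hn => (EReal.coe_lt_coe_iff.1 (hN n hn)).le

lemma ConditionI.exists_upper_bound (hi : ConditionI F α) :
    ∃ M, 0 < M ∧ ∀ n, 1 ≤ n → α n ≤ M := by
  obtain ⟨m, hm, -⟩ := EReal.lt_iff_exists_real_btwn.1 hi.limsup_lt_top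
  obtain ⟨N, hN⟩ := eventually_atTop.1 (eventually_lt_of_limsup_lt hm)
  -- An upper bound for `α` is a lower bound for its reciprocals; `max m 1` keeps the constant
  -- positive and `N + 1` keeps the index at least `1`.
  obtain ⟨c, hc, h⟩ := exists_pos_lower_bound (u := fun n => (α n)⁻¹) (m := (max m 1)⁻¹)
    (fun n hn => inv_pos.2 (hi.pos n hn)) (N + 1) (by positivity) fun n hn =>
      inv_anti₀ (hi.pos n (by omega))
        ((EReal.coe_lt_coe_iff.1 (hN n (by omega))).le.trans (le_max_left _ _))
  exact ⟨c⁻¹, inv_pos.2 hc, fun n hn => (le_inv_comm₀ hc (hi.pos n hn)).1 (h n hn)⟩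

lemma ConditionI.exists_abs_le_one (hi : ConditionI F α) :
    ∃ t₀, 0 < t₀ ∧ ∀ n, 1 ≤ n → ∀ t, 0 < t → t ≤ t₀ → |F n t / t - α n| ≤ 1 := by
  have h := hi.tendsto_sup.eventually (gt_mem_nhds (show (0 : ENNReal) < 1 by norm_num))
  obtain ⟨t₀, ht₀, h⟩ := mem_nhdsGT_iff_exists_Ioc_subset.1 h
  refine ⟨t₀, ht₀, fun n hn t ht htt => ?_⟩
  have h1 : (⨆ (n : ℕ) (_ : 1 ≤ n), ENNReal.ofReal |F n t / t - α n|) < 1 := h ⟨ht, htt⟩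
  have h2 := (le_iSup₂ (f := fun (n : ℕ) (_ : 1 ≤ n) => ENNReal.ofReal |F n t / t - α n|)
    n hn).trans h1.le
  exact ENNReal.ofReal_le_one.1 h2

/-- Near `0` the ratio is at most `M + 1` by (i); beyond `t₀` the bound `F ≤ 1 ≤ u / t₀` suffices.
The constant `L` serves both as tail constant and as bound for the rounding error. -/
lemma ConditionI.exists_linear_bound (hi : ConditionI F α)
    (hF : ∀ n, 1 ≤ n → IsDistributionFunction (F n)) :
    ∃ L, 1 ≤ L ∧ ∀ n, 1 ≤ n → ∀ u, 0 < u → F n u ≤ L * u := by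
  obtain ⟨M, hM, hα⟩ := hi.exists_upper_bound
  obtain ⟨t₀, ht₀, h⟩ := hi.exists_abs_le_one
  refine ⟨M + 1 + t₀⁻¹, by have := inv_pos.2 ht₀; linarith, fun n hn u hu => ?_⟩
  rcases le_total u t₀ with hut | hut
  · have h1 := (abs_le.1 (h n hn u hu hut)).2
    have h2 : F n u / u ≤ M + 1 := by linarith [hα n hn]
    rw [div_le_iff₀ hu] at h2
    have : 0 ≤ t₀⁻¹ * u := by positivity
    linarith
  · have h1 := (hF n hn).le_one u
    have h2 : 1 ≤ t₀⁻¹ * u := by rwa [inv_mul_eq_div, one_le_div ht₀]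
    have : 0 ≤ (M + 1) * u := by positivity
    linarith

lemma lintegral_Ioo_zero_eq_lintegral_Ioi_inv {t : ℝ} (ht : 0 < t) (g : ℝ → ENNReal) :
    ∫⁻ u in Ioo 0 t, g u = ∫⁻ x in Ioi t⁻¹, ENNReal.ofReal (x ^ 2)⁻¹ * g x⁻¹ := by
  have himg : (fun x : ℝ => x⁻¹) '' Ioi t⁻¹ = Ioo 0 t := by
    rw [image_inv_eq_inv]
    ext x
    simp only [Set.mem_inv, mem_Ioi, mem_Ioo]
    constructor
    · intro h
      have hx : 0 < x := inv_pos.1 ((inv_pos.2 ht).trans h)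
      exact ⟨hx, (inv_lt_inv₀ ht hx).1 h⟩
    · rintro ⟨h0, h1⟩
      exact (inv_lt_inv₀ ht h0).2 h1
  rw [← himg, lintegral_image_eq_lintegral_abs_deriv_mul (f' := fun x => -(x ^ 2)⁻¹)
    measurableSet_Ioi (fun x hx => (hasDerivAt_inv
      ((inv_pos.2 ht).trans hx).ne').hasDerivWithinAt) inv_injective.injOn]
  refine lintegral_congr fun x => ?_
  rw [abs_neg, abs_of_nonneg (by positivity)]

lemma ConditionII.exists_lintegral_le_one (hii : ConditionII F α) :
    ∃ X, 1 ≤ X ∧ ∀ n, 1 ≤ n →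
      ∫⁻ x in Ioi X, ENNReal.ofReal |F n x⁻¹ - α n * x⁻¹| ≤ 1 := by
  have h := Tendsto.eventually hii (gt_mem_nhds (show (0 : ENNReal) < 1 by norm_num))
  obtain ⟨t₀, ht₀, h⟩ := mem_nhdsGT_iff_exists_Ioc_subset.1 h
  have ht : 0 < min t₀ 1 := lt_min ht₀ one_pos
  refine ⟨(min t₀ 1)⁻¹, (one_le_inv₀ ht).2 (min_le_right _ _), fun n hn => ?_⟩
  have h1 : (⨆ (n : ℕ) (_ : 1 ≤ n), ∫⁻ u in Ioo 0 (min t₀ 1),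
    ENNReal.ofReal ((1 / u) * |F n u / u - α n|)) < 1 := h ⟨ht, min_le_left _ _⟩
  have h2 := (le_iSup₂ (f := fun (n : ℕ) (_ : 1 ≤ n) => ∫⁻ u in Ioo 0 (min t₀ 1),
    ENNReal.ofReal ((1 / u) * |F n u / u - α n|)) n hn).trans h1.le
  refine le_trans (le_of_eq ?_) h2
  rw [lintegral_Ioo_zero_eq_lintegral_Ioi_inv ht]
  refine setLIntegral_congr_fun measurableSet_Ioi fun x hx => ?_
  have hx0 : 0 < x := (inv_pos.2 ht).trans hx
  rw [← ENNReal.ofReal_mul (by positivity)]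
  congr 1
  have : F n x⁻¹ - α n * x⁻¹ = x⁻¹ * (F n x⁻¹ / x⁻¹ - α n) := by field_simp
  rw [this, abs_mul, abs_of_pos (inv_pos.2 hx0)]
  field_simp

lemma intervalIntegrable_comp_inv {G : ℝ → ℝ} (hG : IsDistributionFunction G) {a b : ℝ}
    (ha : 0 < a) (hb : 0 < b) : IntervalIntegrable (fun y => G y⁻¹) volume a b := by
  refine AntitoneOn.intervalIntegrable fun x hx y hy hxy => hG.mono ?_
  have hx0 : 0 < x := (lt_min ha hb).trans_le hx.1
  exact inv_anti₀ hx0 hxy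

/-- The logarithm is the integral of `1/y`, so the integral of `|F n y⁻¹ - α n y⁻¹|` is what must be
bounded. Up to `X` the integrand is at most `1 + M`; beyond `X`, (ii) bounds the integral by `1`. -/
lemma exists_integral_comp_inv_bound (hi : ConditionI F α) (hii : ConditionII F α)
    (hF : ∀ n, 1 ≤ n → IsDistributionFunction (F n)) :
    ∃ K, 0 ≤ K ∧ ∀ n, 1 ≤ n → ∀ a b, 1 ≤ a → a ≤ b →
      |(∫ y in a..b, F n y⁻¹) - α n * (Real.log b - Real.log a)| ≤ K := by
  obtain ⟨M, hM, hα⟩ := hi.exists_upper_bound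
  obtain ⟨X, hX, hint⟩ := hii.exists_lintegral_le_one
  refine ⟨(1 + M) * X + 1, by positivity, fun n hn a b ha hab => ?_⟩
  have ha0 : 0 < a := one_pos.trans_le ha
  have hb0 : 0 < b := ha0.trans_le hab
  have hI := intervalIntegrable_comp_inv (hF n hn) ha0 hb0
  have hJ : IntervalIntegrable (fun y : ℝ => α n * y⁻¹) volume a b :=
    (intervalIntegral.intervalIntegrable_inv (fun x hx => by
      have := (lt_min ha0 hb0).trans_le hx.1
      exact this.ne') continuousOn_id).const_mul _
  rw [← Real.log_div hb0.ne' ha0.ne', ← integral_inv_of_pos ha0 hb0,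
    ← intervalIntegral.integral_const_mul, ← intervalIntegral.integral_sub hI hJ]
  refine (intervalIntegral.abs_integral_le_integral_abs hab).trans ?_
  rw [intervalIntegral.integral_of_le hab, integral_eq_lintegral_of_nonneg_ae
    (ae_of_all _ fun _ => abs_nonneg _) (hI.sub hJ).abs.1.aestronglyMeasurable]
  refine ENNReal.toReal_le_of_le_ofReal (by positivity) ?_
  have hsub : Ioc a b ⊆ Ioc 1 X ∪ Ioi X := fun x hx => by
    rcases le_or_gt x X with h | h
    · exact Or.inl ⟨ha.trans_lt hx.1, h⟩
    · exact Or.inr h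
  refine (lintegral_mono_set hsub).trans ((lintegral_union_le _ _ _).trans ?_)
  rw [ENNReal.ofReal_add (by positivity) zero_le_one, ENNReal.ofReal_one]
  refine add_le_add ?_ (hint n hn)
  have hle : ∀ x ∈ Ioc 1 X, ENNReal.ofReal |F n x⁻¹ - α n * x⁻¹| ≤ ENNReal.ofReal (1 + M) := by
    intro x hx
    refine ENNReal.ofReal_le_ofReal (abs_le.2 ?_)
    have h1 := (hF n hn).nonneg x⁻¹
    have h2 := (hF n hn).le_one x⁻¹
    have h3 : x⁻¹ ≤ 1 := inv_le_one_of_one_le₀ hx.1.le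
    have h4 : 0 ≤ x⁻¹ := inv_nonneg.2 (one_pos.trans hx.1).le
    have h5 := hi.pos n hn
    have h6 : α n * x⁻¹ ≤ M * 1 := mul_le_mul (hα n hn) h3 h4 hM.le
    have h7 : 0 ≤ α n * x⁻¹ := by positivity
    constructor <;> linarith
  refine (setLIntegral_mono measurable_const hle).trans ?_
  rw [setLIntegral_const, Real.volume_Ioc, ← ENNReal.ofReal_mul (by positivity)]
  exact ENNReal.ofReal_le_ofReal (mul_le_mul_of_nonneg_left (by linarith) (by positivity))

end Analysis

/-! ### Moments of truncated variables -/

section Truncation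

variable {Ω : Type*} {m mΩ : MeasurableSpace Ω}

lemma integrable_min_const {ν : Measure Ω} [IsFiniteMeasure ν] {X : Ω → ℝ} (hX : Measurable X)
    (h0 : ∀ᵐ ω ∂ν, 0 ≤ X ω) {c : ℝ} (hc : 0 ≤ c) : Integrable (fun ω => min (X ω) c) ν := by
  refine Integrable.of_bound (hX.min measurable_const).aestronglyMeasurable c ?_
  filter_upwards [h0] with ω h
  rw [Real.norm_of_nonneg (le_min h hc)]
  exact min_le_right _ _

lemma integral_min_const_eq {ν : Measure Ω} [IsFiniteMeasure ν] {X : Ω → ℝ} (hX : Measurable X)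
    (h0 : ∀ᵐ ω ∂ν, 0 ≤ X ω) {c : ℝ} (hc : 0 ≤ c) :
    ∫ ω, min (X ω) c ∂ν = ∫ t in 0..c, ν.real {ω | t ≤ X ω} := by
  rw [(integrable_min_const hX h0 hc).integral_eq_integral_meas_le
    (h0.mono fun ω h => le_min h hc), intervalIntegral.integral_of_le hc,
    setIntegral_eq_of_subset_of_forall_sdiff_eq_zero measurableSet_Ioi Ioc_subset_Ioi_self]
  · refine setIntegral_congr_fun measurableSet_Ioc fun t ht => ?_
    simp only [le_min_iff, ht.2, and_true]
  · intro t ht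
    have : ¬ t ≤ c := fun h => ht.2 ⟨ht.1, h⟩
    simp [this]

/-- Layer-cake formula with weight `2t`: the tail bound makes the integrand at most `2L`, and it
vanishes beyond `c`. -/
lemma integral_min_const_sq_le {ν : Measure Ω} [IsFiniteMeasure ν] {X : Ω → ℝ}
    (hX : Measurable X) (h0 : ∀ᵐ ω ∂ν, 0 ≤ X ω) {L c : ℝ} (hL : 0 ≤ L) (hc : 0 ≤ c)
    (htail : ∀ t, 0 < t → ν.real {ω | t ≤ X ω} ≤ L / t) :
    ∫ ω, (min (X ω) c) ^ 2 ∂ν ≤ 2 * L * c := by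
  rw [integral_eq_lintegral_of_nonneg_ae (ae_of_all _ fun _ => sq_nonneg _)
    ((hX.min measurable_const).pow_const 2).aestronglyMeasurable]
  refine ENNReal.toReal_le_of_le_ofReal (by positivity) ?_
  have h := lintegral_comp_eq_lintegral_meas_le_mul (g := fun t => 2 * t) ν
    (h0.mono fun ω h => le_min h hc) (hX.min (measurable_const (a := c))).aemeasurable
    (fun t _ => (continuous_const.mul continuous_id).intervalIntegrable _ _)
    (by filter_upwards [self_mem_ae_restrict measurableSet_Ioi] with t ht
        exact mul_nonneg zero_le_two (le_of_lt ht))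
  have hsq : ∀ x : ℝ, ∫ t in (0 : ℝ)..x, 2 * t = x ^ 2 := fun x => by
    rw [intervalIntegral.integral_const_mul, integral_id]; ring
  simp only [hsq] at h
  rw [h]
  have hle : ∀ t ∈ Ioi (0 : ℝ), ν {ω | t ≤ min (X ω) c} * ENNReal.ofReal (2 * t) ≤
      (Ioc 0 c).indicator (fun _ => ENNReal.ofReal (2 * L)) t := by
    intro t ht
    have ht : 0 < t := ht
    by_cases htc : t ≤ c
    · rw [indicator_of_mem (show t ∈ Ioc 0 c from ⟨ht, htc⟩)]
      simp only [le_min_iff, htc, and_true]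
      rw [← ofReal_measureReal, ← ENNReal.ofReal_mul measureReal_nonneg]
      refine ENNReal.ofReal_le_ofReal ?_
      calc ν.real {ω | t ≤ X ω} * (2 * t) ≤ L / t * (2 * t) :=
            mul_le_mul_of_nonneg_right (htail t ht) (by positivity)
        _ = 2 * L := by field_simp
    · simp [htc]
  refine (setLIntegral_mono ((measurable_const).indicator measurableSet_Ioc) hle).trans ?_
  refine (setLIntegral_le_lintegral _ _).trans ?_
  rw [lintegral_indicator measurableSet_Ioc, setLIntegral_const, Real.volume_Ioc, sub_zero,
    ← ENNReal.ofReal_mul (by positivity)]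

lemma condExp_le_const {P : Measure Ω} [IsFiniteMeasure P]
    (hm : m ≤ mΩ) {f : Ω → ℝ} (hf : Integrable f P) {B : ℝ}
    (h : ∀ A, MeasurableSet[m] A → ∫ ω in A, f ω ∂P ≤ P.real A * B) :
    ∀ᵐ ω ∂P, (P[f | m]) ω ≤ B := by
  refine ae_of_ae_trim hm (ae_le_of_forall_setIntegral_le (g := fun _ => B)
    (integrable_condExp.trim hm stronglyMeasurable_condExp) (integrable_const _)
    fun s hs _ => ?_)
  rw [← setIntegral_trim hm stronglyMeasurable_condExp hs, setIntegral_condExp hm hf hs,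
    setIntegral_const, smul_eq_mul, measureReal_def, trim_measurableSet_eq hm hs]
  exact h s hs

lemma const_le_condExp {P : Measure Ω} [IsFiniteMeasure P]
    (hm : m ≤ mΩ) {f : Ω → ℝ} (hf : Integrable f P) {B : ℝ}
    (h : ∀ A, MeasurableSet[m] A → P.real A * B ≤ ∫ ω in A, f ω ∂P) :
    ∀ᵐ ω ∂P, B ≤ (P[f | m]) ω := by
  have := condExp_le_const hm hf.neg (B := -B) fun A hA => by
    simp only [Pi.neg_apply, integral_neg]
    linarith [h A hA]
  filter_upwards [this, condExp_neg f m (μ := P)] with ω h1 h2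
  rw [h2, Pi.neg_apply] at h1
  linarith

/-- On each past event the truncated mean is the integral of the tail over `[0, c]`. The part over
`[0, 1]` costs at most `1`; over `[1, c]` the tail is squeezed between two integrals of `G` that are
logarithmic up to `K`, and the shift by `C` costs at most `M log (1 + C)`. -/
lemma abs_condExp_min_const_sub_le {P : Measure Ω} [IsProbabilityMeasure P]
    (hm : m ≤ mΩ) {X : Ω → ℝ} (hX : Measurable X)
    (h0 : ∀ᵐ ω ∂P, 0 ≤ X ω) {G : ℝ → ℝ} (hG : IsDistributionFunction G) {C K β M c : ℝ}
    (hC : 0 ≤ C) (hβ : 0 ≤ β) (hβM : β ≤ M) (hc : 1 ≤ c)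
    (hK : ∀ a b, 1 ≤ a → a ≤ b →
      |(∫ y in a..b, G y⁻¹) - β * (Real.log b - Real.log a)| ≤ K)
    (hupper : ∀ A, MeasurableSet[m] A → ∀ t, 1 ≤ t →
      P.real (A ∩ {ω | t ≤ X ω}) ≤ P.real A * G t⁻¹)
    (hlower : ∀ A, MeasurableSet[m] A → ∀ t, 1 ≤ t →
      P.real A * G (t + C)⁻¹ ≤ P.real (A ∩ {ω | t ≤ X ω})) :
    ∀ᵐ ω ∂P, |(P[fun ω => min (X ω) c | m]) ω - β * Real.log c| ≤
      K + 1 + M * Real.log (1 + C) := by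
  have hc0 : 0 ≤ c := zero_le_one.trans hc
  have hI := integrable_min_const hX h0 hc0
  have hlogC : 0 ≤ Real.log (1 + C) := Real.log_nonneg (by linarith)
  -- `J` is the contribution of levels in `[0, 1]`, where only the trivial bounds on the tail are
  -- used.
  have key : ∀ A, MeasurableSet[m] A → ∃ J, 0 ≤ J ∧ J ≤ P.real A ∧
      ∫ ω in A, min (X ω) c ∂P = J + ∫ t in 1..c, P.real (A ∩ {ω | t ≤ X ω}) ∧
      IntervalIntegrable (fun t => P.real (A ∩ {ω | t ≤ X ω})) volume 1 c := by
    intro A hA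
    have hint : ∀ a b : ℝ, IntervalIntegrable (fun t => P.real (A ∩ {ω | t ≤ X ω}))
        volume a b := fun a b => Antitone.intervalIntegrable fun s t hst =>
      measureReal_mono (inter_subset_inter_right _ fun ω (h : t ≤ X ω) => hst.trans h)
    refine ⟨∫ t in (0 : ℝ)..1, P.real (A ∩ {ω | t ≤ X ω}), ?_, ?_, ?_, hint _ _⟩
    · exact intervalIntegral.integral_nonneg zero_le_one fun _ _ => measureReal_nonneg
    · calc _ ≤ ∫ t in (0 : ℝ)..1, P.real A :=
            intervalIntegral.integral_mono_on zero_le_one (hint _ _) intervalIntegrable_const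
              fun _ _ => measureReal_mono inter_subset_left
        _ = P.real A := by simp
    · rw [integral_min_const_eq hX (ae_restrict_of_ae h0) hc0,
        intervalIntegral.integral_add_adjacent_intervals (hint _ _) (hint _ _)]
      refine intervalIntegral.integral_congr fun t _ => ?_
      rw [measureReal_restrict_apply (measurableSet_le measurable_const hX), inter_comm]
  have hle := condExp_le_const hm hI (B := β * Real.log c + (K + 1)) fun A hA => by
    obtain ⟨J, hJ0, hJ1, hJ, hint⟩ := key A hA
    have h1 : ∫ t in 1..c, P.real (A ∩ {ω | t ≤ X ω}) ≤ P.real A * ∫ t in 1..c, G t⁻¹ := by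
      rw [← intervalIntegral.integral_const_mul]
      exact intervalIntegral.integral_mono_on hc hint
        ((intervalIntegrable_comp_inv hG one_pos (by linarith)).const_mul _)
        fun t ht => hupper A hA t ht.1
    have h2 := (abs_le.1 (hK 1 c le_rfl hc)).2
    rw [Real.log_one, sub_zero] at h2
    have h3 : P.real A * ∫ t in 1..c, G t⁻¹ ≤ P.real A * (β * Real.log c + K) :=
      mul_le_mul_of_nonneg_left (by linarith) measureReal_nonneg
    rw [hJ]
    linarith
  have hge := const_le_condExp hm hI (B := β * Real.log c - (K + M * Real.log (1 + C)))
    fun A hA => by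
    obtain ⟨J, hJ0, hJ1, hJ, hint⟩ := key A hA
    have h0 : ∫ t in 1..c, G (t + C)⁻¹ = ∫ t in (1 + C)..(c + C), G t⁻¹ :=
      intervalIntegral.integral_comp_add_right (fun t => G t⁻¹) C
    have hG' : IntervalIntegrable (fun t => G (t + C)⁻¹) volume 1 c := by
      refine AntitoneOn.intervalIntegrable fun x hx y hy hxy => hG.mono ?_
      rw [uIcc_of_le hc] at hx
      exact inv_anti₀ (by linarith [hx.1]) (by linarith)
    have h1 : P.real A * ∫ t in 1..c, G (t + C)⁻¹ ≤
        ∫ t in 1..c, P.real (A ∩ {ω | t ≤ X ω}) := by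
      rw [← intervalIntegral.integral_const_mul]
      exact intervalIntegral.integral_mono_on hc (hG'.const_mul _) hint
        fun t ht => hlower A hA t ht.1
    have h2 := (abs_le.1 (hK (1 + C) (c + C) (by linarith) (by linarith))).1
    have h4 : β * Real.log c ≤ β * Real.log (c + C) :=
      mul_le_mul_of_nonneg_left (Real.log_le_log (by linarith) (by linarith)) hβ
    have h5 : β * Real.log (1 + C) ≤ M * Real.log (1 + C) :=
      mul_le_mul_of_nonneg_right hβM hlogC
    have h3 : P.real A * (β * Real.log c - (K + M * Real.log (1 + C))) ≤
        P.real A * ∫ t in 1..c, G (t + C)⁻¹ :=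
      mul_le_mul_of_nonneg_left (by rw [h0]; linarith) measureReal_nonneg
    rw [hJ]
    linarith
  have hM : 0 ≤ M * Real.log (1 + C) := mul_nonneg (hβ.trans hβM) hlogC
  filter_upwards [hle, hge] with ω h1 h2
  exact abs_le.2 ⟨by linarith, by linarith⟩

end Truncation

/-! ### Orthogonality of martingale differences -/

section WeakLaw

variable {Ω : Type*} {m mΩ : MeasurableSpace Ω} {P : Measure Ω} [IsProbabilityMeasure P]

/-- The conditional variance is the conditional second moment minus a square. -/
lemma integral_sub_condExp_sq_le (hm : m ≤ mΩ) {f : Ω → ℝ}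
    (hf : MemLp f 2 P) :
    ∫ ω, (f ω - (P[f | m]) ω) ^ 2 ∂P ≤ ∫ ω, f ω ^ 2 ∂P := by
  have h1 := condVar_ae_eq_condExp_sq_sub_sq_condExp hm hf
  have h2 : ∫ ω, (Var[f; P | m]) ω ∂P = ∫ ω, (f ω - (P[f | m]) ω) ^ 2 ∂P := integral_condExp hm
  have hc : MemLp (P[f | m]) 2 P := hf.condExp one_le_two
  rw [← h2, integral_congr_ae h1, ← integral_condExp hm (f := fun ω => f ω ^ 2)]
  refine integral_mono_ae (integrable_condExp.sub hc.integrable_sq) integrable_condExp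
    (ae_of_all _ fun ω => ?_)
  have := sq_nonneg ((P[f | m]) ω)
  simp only [Pi.sub_apply, Pi.pow_apply]
  exact sub_le_self _ this

/-- Orthogonality of the increments of a bounded martingale. -/
lemma integral_sum_sub_condExp_sq_le {𝓖 : ℕ → MeasurableSpace Ω} (h𝓖 : Monotone 𝓖)
    (hle : ∀ n, 𝓖 n ≤ mΩ) {f : ℕ → Ω → ℝ} {B : ℕ → ℝ} (n : ℕ)
    (hf : ∀ k ∈ Finset.Icc 1 n, Measurable[𝓖 (k + 1)] (f k))
    (hB : ∀ k ∈ Finset.Icc 1 n, ∀ᵐ ω ∂P, |f k ω| ≤ B k) :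
    MemLp (fun ω => ∑ k ∈ Finset.Icc 1 n, (f k ω - (P[f k | 𝓖 k]) ω)) 2 P ∧
    ∫ ω, (∑ k ∈ Finset.Icc 1 n, (f k ω - (P[f k | 𝓖 k]) ω)) ^ 2 ∂P ≤
      ∑ k ∈ Finset.Icc 1 n, ∫ ω, f k ω ^ 2 ∂P := by
  have hL : ∀ k ∈ Finset.Icc 1 n, MemLp (f k) 2 P := fun k hk =>
    MemLp.of_bound ((hf k hk).mono (hle _) le_rfl).aestronglyMeasurable (B k) (hB k hk)
  have hD : ∀ k ∈ Finset.Icc 1 n, MemLp (fun ω => f k ω - (P[f k | 𝓖 k]) ω) 2 P :=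
    fun k hk => (hL k hk).sub ((hL k hk).condExp one_le_two)
  refine ⟨memLp_finsetSum _ hD, ?_⟩
  induction n with
  | zero => simp
  | succ n ih =>
    have hsub : ∀ k ∈ Finset.Icc 1 n, k ∈ Finset.Icc 1 (n + 1) := fun k hk => by
      rw [Finset.mem_Icc] at hk ⊢; omega
    have hn : n + 1 ∈ Finset.Icc 1 (n + 1) := by rw [Finset.mem_Icc]; omega
    have ih := ih (fun k hk => hf k (hsub k hk)) (fun k hk => hB k (hsub k hk))
      (fun k hk => hL k (hsub k hk)) (fun k hk => hD k (hsub k hk))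
    set S : Ω → ℝ := fun ω => ∑ k ∈ Finset.Icc 1 n, (f k ω - (P[f k | 𝓖 k]) ω) with hS
    set D : Ω → ℝ := fun ω => f (n + 1) ω - (P[f (n + 1) | 𝓖 (n + 1)]) ω with hDef
    have hSL : MemLp S 2 P := memLp_finsetSum _ fun k hk => hD k (hsub k hk)
    have hDL : MemLp D 2 P := hD _ hn
    have hSm : StronglyMeasurable[𝓖 (n + 1)] S := by
      refine Finset.stronglyMeasurable_fun_sum _ fun k hk => ?_
      rw [Finset.mem_Icc] at hk
      exact (((hf k (by rw [Finset.mem_Icc]; omega)).mono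
        (h𝓖 (by omega)) le_rfl).stronglyMeasurable).sub
        (stronglyMeasurable_condExp.mono (h𝓖 (by omega)))
    -- `S` is known at time `n + 1`, and `D` has zero conditional mean given that σ-algebra.
    have hcross : ∫ ω, S ω * D ω ∂P = 0 := by
      have hint : Integrable (S * D) P := hSL.integrable_mul hDL
      have h1 := condExp_mul_of_stronglyMeasurable_left hSm hint (hDL.integrable one_le_two)
      have h2 : P[D | 𝓖 (n + 1)] =ᵐ[P] 0 := by
        have h3 := condExp_sub ((hL _ hn).integrable one_le_two)
          (integrable_condExp (m := 𝓖 (n + 1)) (f := f (n + 1)) (μ := P)) (𝓖 (n + 1))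
        refine h3.trans ?_
        rw [condExp_of_stronglyMeasurable (hle _) stronglyMeasurable_condExp integrable_condExp,
          sub_self]
      calc ∫ ω, S ω * D ω ∂P = ∫ ω, (P[S * D | 𝓖 (n + 1)]) ω ∂P :=
            (integral_condExp (hle _)).symm
        _ = ∫ ω, (0 : ℝ) ∂P := integral_congr_ae (by
            filter_upwards [h1, h2] with ω h1 h2
            rw [h1, Pi.mul_apply, h2]
            simp)
        _ = 0 := by simp
    have hexp : ∫ ω, (S ω + D ω) ^ 2 ∂P = ∫ ω, S ω ^ 2 ∂P + ∫ ω, D ω ^ 2 ∂P := by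
      have h1 : ∀ ω, (S ω + D ω) ^ 2 = S ω ^ 2 + D ω ^ 2 + 2 * (S ω * D ω) := fun ω => by ring
      simp only [h1]
      have hint : Integrable (fun ω => S ω * D ω) P := hSL.integrable_mul hDL
      have hadd : Integrable (fun ω => S ω ^ 2 + D ω ^ 2) P :=
        hSL.integrable_sq.add hDL.integrable_sq
      rw [integral_add hadd (hint.const_mul 2), integral_add hSL.integrable_sq hDL.integrable_sq, integral_const_mul, hcross]
      ring
    simp only [Finset.sum_Icc_succ_top (show 1 ≤ n + 1 by omega)]
    rw [hexp]
    exact add_le_add ih (integral_sub_condExp_sq_le (hle _) (hL _ hn))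

end WeakLaw

/-! ### The weighted weak law -/

section WeakLaw

variable {Ω : Type*} {mΩ : MeasurableSpace Ω} {P : Measure Ω} [IsProbabilityMeasure P]

/-- The compensators of the truncated variables are close to the logarithmic weighted mean. -/
lemma abs_sum_compensator_sub_le {α w r : ℕ → ℝ} {n : ℕ} {b m M S K : ℝ} (hm : 0 < m)
    (hα : ∀ k, 1 ≤ k → m ≤ α k ∧ α k ≤ M) (hw : ∀ k ∈ Finset.Icc 1 n, 0 < w k) (hb : 1 ≤ b)
    (hS : ∑ k ∈ Finset.Icc 1 n, α k * w k ≤ S) (hK : 0 ≤ K)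
    (hr : ∀ k ∈ Finset.Icc 1 n, |r k - w k * (α k * Real.log (b / w k))| ≤ K * w k) :
    |∑ k ∈ Finset.Icc 1 n, r k + ∑ k ∈ Finset.Icc 1 n, α k * w k * Real.log (α k * w k)| ≤
      S * (Real.log b + (|Real.log m| + |Real.log M|)) + K * (S / m) := by
  have hb0 : 0 < b := one_pos.trans_le hb
  have hlb : 0 ≤ Real.log b := Real.log_nonneg hb
  have hsumw : ∑ k ∈ Finset.Icc 1 n, w k ≤ S / m := by
    rw [le_div_iff₀ hm, mul_comm, Finset.mul_sum]
    refine le_trans (Finset.sum_le_sum fun k hk => ?_) hS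
    exact mul_le_mul_of_nonneg_right (hα k (Finset.mem_Icc.1 hk).1).1 (hw k hk).le
  rw [← Finset.sum_add_distrib]
  set Λ := |Real.log m| + |Real.log M|
  have hterm : ∀ k ∈ Finset.Icc 1 n, |r k + α k * w k * Real.log (α k * w k)| ≤
      α k * w k * (Real.log b + Λ) + K * w k := by
    intro k hk
    obtain ⟨h1, h2⟩ := hα k (Finset.mem_Icc.1 hk).1
    have hα0 : 0 < α k := hm.trans_le h1
    have hwk := hw k hk
    have hlog : |Real.log (α k)| ≤ Λ := by
      refine abs_le.2 ⟨?_, ?_⟩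
      · linarith [Real.log_le_log hm h1, neg_abs_le (Real.log m), abs_nonneg (Real.log M)]
      · linarith [Real.log_le_log hα0 h2, le_abs_self (Real.log M), abs_nonneg (Real.log m)]
    have heq : r k + α k * w k * Real.log (α k * w k) =
        (r k - w k * (α k * Real.log (b / w k))) +
          α k * w k * (Real.log b + Real.log (α k)) := by
      rw [Real.log_mul hα0.ne' hwk.ne', Real.log_div hb0.ne' hwk.ne']
      ring
    rw [heq]
    refine (abs_add_le _ _).trans ?_
    rw [add_comm, abs_mul, abs_of_pos (mul_pos hα0 hwk)]
    refine add_le_add (mul_le_mul_of_nonneg_left ?_ (mul_pos hα0 hwk).le) (hr k hk)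
    refine (abs_add_le _ _).trans ?_
    rw [abs_of_nonneg hlb]
    linarith
  refine (Finset.abs_sum_le_sum_abs _ _).trans ((Finset.sum_le_sum hterm).trans ?_)
  rw [Finset.sum_add_distrib, ← Finset.sum_mul, ← Finset.mul_sum]
  refine add_le_add (mul_le_mul_of_nonneg_right hS ?_) (mul_le_mul_of_nonneg_left hsumw hK)
  positivity

/-- Chebyshev's inequality for the compensated truncated sum, together with the union bound for
the probability that the truncation is effective. -/
lemma measureReal_weighted_sum_le {𝓖 : ℕ → MeasurableSpace Ω} (h𝓖 : Monotone 𝓖)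
    (hle : ∀ n, 𝓖 n ≤ mΩ) {X : ℕ → Ω → ℝ} (hX : ∀ k, 1 ≤ k → Measurable[𝓖 (k + 1)] (X k))
    (h0 : ∀ k, 1 ≤ k → ∀ᵐ ω ∂P, 0 ≤ X k ω) {L : ℝ} (hL : 0 ≤ L)
    (htail : ∀ k, 1 ≤ k → ∀ t, 0 < t → P.real {ω | t ≤ X k ω} ≤ L / t)
    {w : ℕ → ℝ} {n : ℕ} (hw : ∀ k ∈ Finset.Icc 1 n, 0 < w k) {b ε ℓ : ℝ} (hb : 0 < b)
    (hε : 0 < ε)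
    (hcomp : ∀ᵐ ω ∂P, |1 / b * ∑ k ∈ Finset.Icc 1 n,
      (P[fun ω => w k * min (X k ω) (b / w k) | 𝓖 k]) ω - ℓ| < ε / 2) :
    P.real {ω | ε ≤ ‖1 / b * ∑ k ∈ Finset.Icc 1 n, w k * X k ω - ℓ‖} ≤
      (L + 8 * L / ε ^ 2) * (∑ k ∈ Finset.Icc 1 n, w k) / b := by
  set f : ℕ → Ω → ℝ := fun k ω => w k * min (X k ω) (b / w k) with hf
  set T : Ω → ℝ := fun ω => ∑ k ∈ Finset.Icc 1 n, (f k ω - (P[f k | 𝓖 k]) ω) with hT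
  have hXm : ∀ k ∈ Finset.Icc 1 n, Measurable (X k) := fun k hk =>
    (hX k (Finset.mem_Icc.1 hk).1).mono (hle _) le_rfl
  obtain ⟨hTL, hT2⟩ := integral_sum_sub_condExp_sq_le (P := P) h𝓖 hle (f := f)
    (B := fun _ => b) n
    (fun k hk => ((hX k (Finset.mem_Icc.1 hk).1).min measurable_const).const_mul _)
    (fun k hk => by
      have hwk := hw k hk
      filter_upwards [h0 k (Finset.mem_Icc.1 hk).1] with ω h
      have h1 : 0 ≤ min (X k ω) (b / w k) := le_min h (by positivity)
      rw [hf, abs_of_nonneg (mul_nonneg hwk.le h1)]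
      calc w k * min (X k ω) (b / w k) ≤ w k * (b / w k) :=
            mul_le_mul_of_nonneg_left (min_le_right _ _) hwk.le
        _ = b := by field_simp)
  have hT3 : ∫ ω, T ω ^ 2 ∂P ≤ 2 * L * b * ∑ k ∈ Finset.Icc 1 n, w k := by
    refine hT2.trans ?_
    rw [Finset.mul_sum]
    refine Finset.sum_le_sum fun k hk => ?_
    have hwk := hw k hk
    have h1 := (Finset.mem_Icc.1 hk).1
    simp only [hf, mul_pow]
    rw [integral_const_mul]
    calc w k ^ 2 * ∫ ω, (min (X k ω) (b / w k)) ^ 2 ∂P ≤ w k ^ 2 * (2 * L * (b / w k)) :=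
          mul_le_mul_of_nonneg_left (integral_min_const_sq_le (hXm k hk) (h0 k h1) hL
            (by positivity) (htail k h1)) (by positivity)
      _ = 2 * L * b * w k := by field_simp
  -- The constant is `2L` divided by `(ε / 2) ^ 2`; one factor `b` cancels.
  have hcheb : P.real {ω | (ε * b / 2) ^ 2 ≤ T ω ^ 2} ≤
      8 * L / ε ^ 2 * (∑ k ∈ Finset.Icc 1 n, w k) / b := by
    have h1 := mul_meas_ge_le_integral_of_nonneg (μ := P) (f := fun ω => T ω ^ 2)
      (ae_of_all _ fun _ => sq_nonneg _) hTL.integrable_sq ((ε * b / 2) ^ 2)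
    have h2 : 0 < (ε * b / 2) ^ 2 := by positivity
    rw [mul_comm, ← le_div_iff₀ h2] at h1
    refine h1.trans ((div_le_div_of_nonneg_right hT3 h2.le).trans (le_of_eq ?_))
    field_simp
    ring
  have hunion : P.real (⋃ k ∈ Finset.Icc 1 n, {ω | b / w k ≤ X k ω}) ≤
      L * (∑ k ∈ Finset.Icc 1 n, w k) / b := by
    refine (measureReal_biUnion_finset_le _ _).trans ?_
    rw [Finset.mul_sum, Finset.sum_div]
    refine Finset.sum_le_sum fun k hk => ?_
    have hwk := hw k hk
    refine (htail k (Finset.mem_Icc.1 hk).1 _ (by positivity)).trans (le_of_eq ?_)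
    field_simp
  -- Outside the union no truncation is effective, so the full sum is `T` plus the compensators;
  -- each of the two deviations is then below `ε / 2`.
  have hsub : {ω | ε ≤ ‖1 / b * ∑ k ∈ Finset.Icc 1 n, w k * X k ω - ℓ‖} ≤ᵐ[P]
      ((⋃ k ∈ Finset.Icc 1 n, {ω | b / w k ≤ X k ω}) ∪ {ω | (ε * b / 2) ^ 2 ≤ T ω ^ 2} :
        Set Ω) := by
    filter_upwards [hcomp] with ω hω hmem
    by_contra hnot
    have hmem : ε ≤ ‖1 / b * ∑ k ∈ Finset.Icc 1 n, w k * X k ω - ℓ‖ := hmem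
    have hnot : ¬ (ω ∈ (⋃ k ∈ Finset.Icc 1 n, {ω | b / w k ≤ X k ω}) ∪
      {ω | (ε * b / 2) ^ 2 ≤ T ω ^ 2}) := hnot
    simp only [mem_union, mem_iUnion, mem_ofPred_eq, not_or, not_exists, not_le] at hnot
    obtain ⟨h1, h2⟩ := hnot
    have h3 : |T ω| < ε * b / 2 := abs_lt_of_sq_lt_sq h2 (by positivity)
    have h4 : 1 / b * ∑ k ∈ Finset.Icc 1 n, w k * X k ω - ℓ = 1 / b * T ω +
        (1 / b * ∑ k ∈ Finset.Icc 1 n, (P[f k | 𝓖 k]) ω - ℓ) := by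
      have h5 : ∑ k ∈ Finset.Icc 1 n, w k * X k ω =
          T ω + ∑ k ∈ Finset.Icc 1 n, (P[f k | 𝓖 k]) ω := by
        simp only [hT]
        rw [← Finset.sum_add_distrib]
        refine Finset.sum_congr rfl fun k hk => ?_
        simp only [hf]
        rw [sub_add_cancel, min_eq_left (h1 k hk).le]
      rw [h5]
      ring
    have h6 : |1 / b * T ω| < ε / 2 := by
      rw [abs_mul, abs_of_pos (by positivity : 0 < 1 / b), one_div_mul_eq_div, div_lt_iff₀ hb]
      linarith
    rw [h4, Real.norm_eq_abs] at hmem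
    linarith [abs_add_le (1 / b * T ω) (1 / b * ∑ k ∈ Finset.Icc 1 n, (P[f k | 𝓖 k]) ω - ℓ)]
  calc _ ≤ P.real ((⋃ k ∈ Finset.Icc 1 n, {ω | b / w k ≤ X k ω}) ∪
        {ω | (ε * b / 2) ^ 2 ≤ T ω ^ 2}) :=
        ENNReal.toReal_mono (measure_ne_top _ _) (measure_mono_ae hsub)
    _ ≤ _ := (measureReal_union_le _ _).trans (add_le_add hunion hcheb)
    _ = _ := by ring

/-- Weighted weak law for variables whose truncated conditional means grow logarithmically. -/
theorem tendstoInMeasure_weighted_sum {𝓖 : ℕ → MeasurableSpace Ω} (h𝓖 : Monotone 𝓖)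
    (hle : ∀ n, 𝓖 n ≤ mΩ) {X : ℕ → Ω → ℝ} (hX : ∀ k, 1 ≤ k → Measurable[𝓖 (k + 1)] (X k))
    (h0 : ∀ k, 1 ≤ k → ∀ᵐ ω ∂P, 0 ≤ X k ω) {L K m M S ℓ : ℝ} (hL : 0 ≤ L) (hK : 0 ≤ K)
    (htail : ∀ k, 1 ≤ k → ∀ t, 0 < t → P.real {ω | t ≤ X k ω} ≤ L / t) {α : ℕ → ℝ}
    (hm : 0 < m) (hα : ∀ k, 1 ≤ k → m ≤ α k ∧ α k ≤ M)
    (hmean : ∀ k, 1 ≤ k → ∀ c, 1 ≤ c →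
      ∀ᵐ ω ∂P, |(P[fun ω => min (X k ω) c | 𝓖 k]) ω - α k * Real.log c| ≤ K)
    {a : ℕ → ℕ → ℝ} (ha : ∀ n k, 1 ≤ k → k ≤ n → 0 < a k n) {b : ℕ → ℝ}
    (hb : Tendsto b atTop atTop)
    (hlim : Tendsto (fun n : ℕ =>
      (∑ k ∈ Finset.Icc 1 n, α k * a k n * Real.log (α k * a k n)) / b n) atTop (𝓝 (-ℓ)))
    (hS : ∀ n, 1 ≤ n → ∑ k ∈ Finset.Icc 1 n, α k * a k n ≤ S) :
    TendstoInMeasure P (fun (n : ℕ) (ω : Ω) => 1 / b n * ∑ k ∈ Finset.Icc 1 n, a k n * X k ω)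
      atTop (fun _ => ℓ) := by
  rw [tendstoInMeasure_iff_measureReal_norm]
  intro ε hε
  set Λ := |Real.log m| + |Real.log M|
  have hw : ∀ n, ∀ k ∈ Finset.Icc 1 n, 0 < a k n := fun n k hk =>
    ha n k (Finset.mem_Icc.1 hk).1 (Finset.mem_Icc.1 hk).2
  have hsum : ∀ n, 1 ≤ n → ∑ k ∈ Finset.Icc 1 n, a k n ≤ S / m := fun n hn => by
    rw [le_div_iff₀ hm, mul_comm, Finset.mul_sum]
    refine le_trans (Finset.sum_le_sum fun k hk => ?_) (hS n hn)
    exact mul_le_mul_of_nonneg_right (hα k (Finset.mem_Icc.1 hk).1).1 (hw n k hk).le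
  have herr : Tendsto (fun n => |(∑ k ∈ Finset.Icc 1 n, α k * a k n * Real.log (α k * a k n)) /
      b n - (-ℓ)| + (S * (Real.log (b n) + Λ) + K * (S / m)) / b n) atTop (𝓝 0) := by
    have h1 : Tendsto (fun n => |(∑ k ∈ Finset.Icc 1 n, α k * a k n *
        Real.log (α k * a k n)) / b n - (-ℓ)|) atTop (𝓝 0) := by
      have := (hlim.sub_const (-ℓ)).abs
      rwa [sub_self, abs_zero] at this
    have h2 : Tendsto (fun n => Real.log (b n) / b n) atTop (𝓝 0) :=
      Real.isLittleO_log_id_atTop.tendsto_div_nhds_zero.comp hb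
    have h3 : Tendsto (fun n => (S * Λ + K * (S / m)) / b n) atTop (𝓝 0) :=
      hb.const_div_atTop _
    have h4 := h1.add ((h2.const_mul S).add h3)
    simp only [mul_zero, add_zero] at h4
    refine h4.congr fun n => ?_
    ring
  have hbound : Tendsto (fun n => (L + 8 * L / ε ^ 2) * (S / m) / b n) atTop (𝓝 0) :=
    hb.const_div_atTop _
  refine squeeze_zero' (Eventually.of_forall fun _ => measureReal_nonneg) ?_ hbound
  filter_upwards [eventually_ge_atTop 1, hb.eventually_ge_atTop 1,
    hb.eventually_ge_atTop (S / m), herr.eventually (gt_mem_nhds (half_pos hε))]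
    with n hn hb1 hbS hen
  have hb0 : 0 < b n := one_pos.trans_le hb1
  -- A single weight is at most the sum of all, hence at most `S / m ≤ b n`: the truncation level is
  -- in the range of `hmean`.
  have hc : ∀ k ∈ Finset.Icc 1 n, 1 ≤ b n / a k n := fun k hk => by
    rw [one_le_div (hw n k hk)]
    exact ((Finset.single_le_sum (fun i hi => (hw n i hi).le) hk).trans (hsum n hn)).trans hbS
  have hcomp : ∀ᵐ ω ∂P, |1 / b n * ∑ k ∈ Finset.Icc 1 n,
      (P[fun ω => a k n * min (X k ω) (b n / a k n) | 𝓖 k]) ω - ℓ| < ε / 2 := by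
    have hae : ∀ᵐ ω ∂P, ∀ k ∈ Finset.Icc 1 n,
        |(P[fun ω => a k n * min (X k ω) (b n / a k n) | 𝓖 k]) ω -
          a k n * (α k * Real.log (b n / a k n))| ≤ K * a k n := by
      refine (Finset.eventually_all _).2 fun k hk => ?_
      filter_upwards [hmean k (Finset.mem_Icc.1 hk).1 _ (hc k hk),
        condExp_smul (μ := P) (a k n) (fun ω => min (X k ω) (b n / a k n)) (𝓖 k)] with ω h1 h2
      have h3 : (P[fun ω => a k n * min (X k ω) (b n / a k n) | 𝓖 k]) ω =
        a k n * (P[fun ω => min (X k ω) (b n / a k n) | 𝓖 k]) ω := h2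
      rw [h3, ← mul_sub, abs_mul, abs_of_pos (hw n k hk), mul_comm]
      exact mul_le_mul_of_nonneg_right h1 (hw n k hk).le
    filter_upwards [hae] with ω hω
    have h1 := abs_sum_compensator_sub_le hm hα (hw n) hb1 (hS n hn) hK hω
    refine lt_of_le_of_lt ?_ hen
    set U := ∑ k ∈ Finset.Icc 1 n, (P[fun ω => a k n * min (X k ω) (b n / a k n) | 𝓖 k]) ω
    set V := ∑ k ∈ Finset.Icc 1 n, α k * a k n * Real.log (α k * a k n)
    have h2 : 1 / b n * U - ℓ = (U + V) / b n - (V / b n - (-ℓ)) := by ring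
    rw [h2]
    refine (abs_sub _ _).trans ((add_comm _ _).le.trans (add_le_add le_rfl ?_))
    rw [abs_div, abs_of_pos hb0]
    exact div_le_div_of_nonneg_right h1 hb0.le
  refine (measureReal_weighted_sum_le h𝓖 hle hX h0 hL htail (hw n) hb0 hε hcomp).trans ?_
  exact div_le_div_of_nonneg_right
    (mul_le_mul_of_nonneg_left (hsum n hn) (by positivity)) hb0.le

end WeakLaw

/-! ### Conditional tails of `R_n` in the Oppenheim scheme -/

section Scheme

variable {Ω : Type*}

/-- The random tuple `(Θ_1, …, Θ_n)`. -/
def past (Θ : ℕ → Ω → ℕ) (n : ℕ) (ω : Ω) : Fin n → ℕ := initial n fun j => Θ j ω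

/-- The σ-algebra generated by `Θ_1, …, Θ_n`. -/
@[reducible] def pastSigma (Θ : ℕ → Ω → ℕ) (n : ℕ) : MeasurableSpace Ω :=
  MeasurableSpace.comap (past Θ n) inferInstance

lemma measurable_pastSigma_past (Θ : ℕ → Ω → ℕ) (n : ℕ) :
    Measurable[pastSigma Θ n] (past Θ n) := comap_measurable _

lemma measurable_pastSigma_apply (Θ : ℕ → Ω → ℕ) {n j : ℕ} (hj : 1 ≤ j) (hjn : j ≤ n) :
    Measurable[pastSigma Θ n] (Θ j) := by
  have h : Θ j = (fun x : Fin n → ℕ => x ⟨j - 1, by omega⟩) ∘ past Θ n := by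
    funext ω
    simp only [Function.comp, past, initial]
    congr 1
    omega
  rw [h]
  exact (measurable_pi_apply _).comp (measurable_pastSigma_past Θ n)

lemma pastSigma_le {Θ : ℕ → Ω → ℕ} {n : ℕ} {m : MeasurableSpace Ω}
    (h : ∀ j, 1 ≤ j → j ≤ n → Measurable[m] (Θ j)) : pastSigma Θ n ≤ m :=
  Measurable.comap_le (measurable_pi_lambda _ fun i => h (i + 1) (by omega) (by omega))

lemma pastSigma_mono (Θ : ℕ → Ω → ℕ) : Monotone (pastSigma Θ) := fun _ _ hnk =>
  pastSigma_le fun _ h1 h2 => measurable_pastSigma_apply Θ h1 (h2.trans hnk)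

lemma mem_history_iff {Θ : ℕ → Ω → ℕ} {n : ℕ} {h : ℕ → ℕ} {ω : Ω} :
    ω ∈ history Θ n h ↔ past Θ n ω = initial n h := by
  constructor
  · intro hω
    funext i
    exact hω (i + 1) (by omega) (by omega)
  · intro hω j h1 h2
    have := congrFun hω ⟨j - 1, by omega⟩
    simp only [past, initial] at this
    rwa [Nat.sub_add_cancel h1] at this

lemma measurable_R (φ : ℕ → ℕ → ℝ) (q : (n : ℕ) → (Fin n → ℕ) → ℝ) (Θ : ℕ → Ω → ℕ) {n : ℕ}
    (hn : 1 ≤ n) : Measurable[pastSigma Θ (n + 1)] (R φ q Θ n) := by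
  have h1 : Measurable[pastSigma Θ (n + 1)] fun ω => (Θ (n + 1) ω : ℝ) :=
    measurable_from_top.comp (measurable_pastSigma_apply Θ (by omega) le_rfl)
  have h2 : Measurable[pastSigma Θ (n + 1)] fun ω => φ n (Θ n ω) :=
    measurable_from_top.comp (measurable_pastSigma_apply Θ hn (by omega))
  have h3 : Measurable[pastSigma Θ (n + 1)] fun ω => Q q Θ n ω :=
    (Measurable.of_discrete (f := q n)).comp
      ((measurable_pastSigma_past Θ n).mono (pastSigma_mono Θ n.le_succ) le_rfl)
  exact (h1.add (h2.mul h3)).div (h2.mul (measurable_const.add h3))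

/-- The sample point gives an admissible sequence of integers. -/
def IsAdmissiblePoint (φ : ℕ → ℕ → ℝ) (Θ : ℕ → Ω → ℕ) (ω : Ω) : Prop :=
  1 ≤ Θ 1 ω ∧ ∀ n, 1 ≤ n → φ n (Θ n ω) ≤ Θ (n + 1) ω

variable [mΩ : MeasurableSpace Ω] {P : Measure Ω} {F : ℕ → ℝ → ℝ}
  {φ : ℕ → ℕ → ℝ} {q : (n : ℕ) → (Fin n → ℕ) → ℝ} {Θ : ℕ → Ω → ℕ}

namespace IsScheme

lemma pastSigma_le (hΘ : IsScheme P F φ q Θ) (n : ℕ) : pastSigma Θ n ≤ mΩ :=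
  Oppenheim.pastSigma_le fun j hj _ => hΘ.measurable j hj

lemma ae_isAdmissiblePoint (hΘ : IsScheme P F φ q Θ) :
    ∀ᵐ ω ∂P, IsAdmissiblePoint φ Θ ω := by
  filter_upwards [hΘ.ae_one_le, ae_all_iff.2 fun n => ae_all_iff.2 fun hn => hΘ.ae_phi_le n hn]
    with ω h1 h2
  exact ⟨h1, h2⟩

lemma one_le (hΘ : IsScheme P F φ q Θ) {ω : Ω} (hω : IsAdmissiblePoint φ Θ ω) {n : ℕ}
    (hn : 1 ≤ n) : 1 ≤ Θ n ω := by
  induction n, hn using Nat.le_induction with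
  | base => exact hω.1
  | succ n hn ih =>
    have := (hΘ.phi_pos n hn _ ih).trans_le (hω.2 n hn)
    exact_mod_cast this

lemma measurableSet_history (hΘ : IsScheme P F φ q Θ) (n : ℕ) (h : ℕ → ℕ) :
    MeasurableSet (history Θ n h) := by
  have : history Θ n h = past Θ n ⁻¹' {initial n h} := by
    ext ω
    exact mem_history_iff
  rw [this]
  exact hΘ.pastSigma_le n _ (measurable_pastSigma_past Θ n (measurableSet_singleton _))

lemma ae_nonneg_R (hΘ : IsScheme P F φ q Θ) {n : ℕ} (hn : 1 ≤ n) :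
    ∀ᵐ ω ∂P, 0 ≤ R φ q Θ n ω := by
  filter_upwards [hΘ.ae_isAdmissiblePoint] with ω hω
  have h1 := hΘ.phi_pos n hn _ (hΘ.one_le hω hn)
  have h2 : 0 ≤ Q q Θ n ω := hΘ.q_nonneg n hn _
  unfold R
  positivity

section Atom

variable [IsProbabilityMeasure P] {n : ℕ} {x : Ω}

lemma measureReal_history_inter_eq (hΘ : IsScheme P F φ q Θ) (hn : 1 ≤ n)
    (hx : IsAdmissiblePoint φ Θ x) {k : ℕ} (hk : φ n (Θ n x) ≤ k) :
    P.real (history Θ n (fun j => Θ j x) ∩ {ω | Θ (n + 1) ω = k}) =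
      P.real (history Θ n (fun j => Θ j x)) *
        (F n (delta φ n (Θ n x) k (Q q Θ n x)) - F n (delta φ n (Θ n x) (k + 1) (Q q Θ n x))) := by
  by_cases h0 : P (history Θ n (fun j => Θ j x)) = 0
  · rw [measureReal_def, measureReal_def, measure_mono_null inter_subset_left h0, h0]
    simp
  -- The conditional law is stated along an integer sequence, so the value `k` is spliced into the
  -- trajectory of `x` at index `n + 1`.
  set h : ℕ → ℕ := Function.update (fun j => Θ j x) (n + 1) k with hdef
  have hlow : ∀ j, j ≤ n → h j = Θ j x := fun j hj =>
    Function.update_of_ne (by omega) _ _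
  have htop : h (n + 1) = k := Function.update_self _ _ _
  have hhist : history Θ n h = history Θ n (fun j => Θ j x) := by
    ext ω
    refine forall_congr' fun j => forall_congr' fun _ => forall_congr' fun hj => ?_
    rw [hlow j hj]
  have hinit : initial n h = initial n fun j => Θ j x := by
    funext i
    exact hlow _ (by omega)
  have hadm : Admissible φ n h := by
    refine ⟨by rw [hlow 1 hn]; exact hx.1, fun j h1 h2 => ?_⟩
    rcases Nat.lt_or_ge j n with h3 | h3
    · rw [hlow j h2, hlow (j + 1) h3]
      exact hx.2 j h1
    · obtain rfl : j = n := by omega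
      rwa [hlow j h2, htop]
  have hlaw := hΘ.cond_law n hn h hadm (by rwa [hhist])
  rw [hhist, hinit, htop, hlow n le_rfl, cond_apply (hΘ.measurableSet_history _ _),
    ENNReal.toReal_mul, ENNReal.toReal_inv] at hlaw
  have hpos : (P (history Θ n (fun j => Θ j x))).toReal ≠ 0 :=
    (ENNReal.toReal_pos h0 (measure_ne_top _ _)).ne'
  unfold Q
  rw [← hlaw, measureReal_def, measureReal_def, ← mul_assoc, mul_inv_cancel₀ hpos, one_mul]

/-- The point probabilities telescope, and the far end vanishes because `δ` tends to `0` from the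
right, where `F n` is right-continuous with value `0`. -/
lemma measureReal_history_inter_ge (hΘ : IsScheme P F φ q Θ)
    (hF : IsDistributionFunction (F n)) (hn : 1 ≤ n)
    (hx : IsAdmissiblePoint φ Θ x) {k : ℕ} (hk : φ n (Θ n x) ≤ k) :
    P.real (history Θ n (fun j => Θ j x) ∩ {ω | k ≤ Θ (n + 1) ω}) =
      P.real (history Θ n (fun j => Θ j x)) * F n (delta φ n (Θ n x) k (Q q Θ n x)) := by
  set H := history Θ n (fun j => Θ j x) with hH
  set d : ℕ → ℝ := fun k => delta φ n (Θ n x) k (Q q Θ n x) with hd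
  have hφ := hΘ.phi_pos n hn _ (hΘ.one_le hx hn)
  have hq : 0 ≤ Q q Θ n x := hΘ.q_nonneg n hn _
  have hHm : MeasurableSet H := hΘ.measurableSet_history _ _
  have hfin : ∀ N : ℕ, P.real (H ∩ {ω | k ≤ Θ (n + 1) ω ∧ Θ (n + 1) ω < k + N}) =
      P.real H * (F n (d k) - F n (d (k + N))) := by
    intro N
    induction N with
    | zero =>
      have : {ω | k ≤ Θ (n + 1) ω ∧ Θ (n + 1) ω < k + 0} = ∅ := by
        ext ω
        simp
      rw [this]
      simp
    | succ N ih =>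
      have hsplit : H ∩ {ω | k ≤ Θ (n + 1) ω ∧ Θ (n + 1) ω < k + (N + 1)} =
          (H ∩ {ω | k ≤ Θ (n + 1) ω ∧ Θ (n + 1) ω < k + N}) ∪
            (H ∩ {ω | Θ (n + 1) ω = k + N}) := by
        rw [← inter_union_distrib_left]
        congr 1
        ext ω
        change (k ≤ Θ (n + 1) ω ∧ Θ (n + 1) ω < k + (N + 1)) ↔
          ((k ≤ Θ (n + 1) ω ∧ Θ (n + 1) ω < k + N) ∨ Θ (n + 1) ω = k + N)
        omega
      have hm : MeasurableSet (H ∩ {ω | Θ (n + 1) ω = k + N}) :=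
        hHm.inter (hΘ.measurable (n + 1) (by omega) (measurableSet_singleton (k + N)))
      rw [hsplit, measureReal_union _ hm, ih,
        hΘ.measureReal_history_inter_eq hn hx (k := k + N)
          (hk.trans (by exact_mod_cast Nat.le_add_right k N))]
      · simp only [hd, hH, ← add_assoc]
        ring
      · refine disjoint_left.2 fun ω h1 h2 => ?_
        have h3 : Θ (n + 1) ω < k + N := h1.2.2
        have h4 : Θ (n + 1) ω = k + N := h2.2
        omega
  have hlim1 : Tendsto (fun N : ℕ =>
      P.real (H ∩ {ω | k ≤ Θ (n + 1) ω ∧ Θ (n + 1) ω < k + N})) atTop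
      (𝓝 (P.real (H ∩ {ω | k ≤ Θ (n + 1) ω}))) := by
    have hU : H ∩ {ω | k ≤ Θ (n + 1) ω} =
        ⋃ N : ℕ, H ∩ {ω | k ≤ Θ (n + 1) ω ∧ Θ (n + 1) ω < k + N} := by
      rw [← inter_iUnion]
      congr 1
      ext ω
      rw [mem_iUnion]
      exact ⟨fun h => ⟨Θ (n + 1) ω + 1, h, by omega⟩, fun ⟨_, h⟩ => h.1⟩
    rw [hU]
    refine (ENNReal.tendsto_toReal (measure_ne_top _ _)).comp (tendsto_measure_iUnion_atTop ?_)
    exact fun N N' hN => inter_subset_inter_right _ fun ω h => ⟨h.1, h.2.trans_le (by omega)⟩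
  have hd0 : Tendsto (fun N : ℕ => d (k + N)) atTop (𝓝[≥] 0) := by
    refine tendsto_nhdsWithin_iff.2 ⟨?_, Eventually.of_forall fun N => ?_⟩
    · have h1 : Tendsto (fun N : ℕ => ((k + N : ℕ) : ℝ) + φ n (Θ n x) * Q q Θ n x) atTop atTop :=
        tendsto_atTop_add_const_right _ _ (tendsto_natCast_atTop_atTop.comp
          (tendsto_atTop_mono (fun N => Nat.le_add_left N k) tendsto_id))
      exact h1.const_div_atTop _
    · change 0 ≤ delta _ _ _ _ _
      unfold delta
      positivity
  have hlim2 : Tendsto (fun N : ℕ => P.real H * (F n (d k) - F n (d (k + N)))) atTop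
      (𝓝 (P.real H * F n (d k))) := by
    have h1 := (hF.right_continuous 0).tendsto.comp hd0
    rw [hF.eq_zero 0 le_rfl] at h1
    simpa using (h1.const_sub (F n (d k))).const_mul (P.real H)
  exact tendsto_nhds_unique hlim1 (hlim2.congr fun N => (hfin N).symm)

/-- Given the history, `Θ_{n+1}` is almost surely at least `⌈φ⌉`, so the tail formula forces `F n =
1` at the corresponding `δ`. As the denominator of `δ` is at least `1`, `F n u ≤ L u` keeps `φ (1 +
q)` away from `0`. -/
lemma one_le_mul_phi (hΘ : IsScheme P F φ q Θ) (hF : IsDistributionFunction (F n))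
    (hn : 1 ≤ n) {L : ℝ} (hL : ∀ u, 0 < u → F n u ≤ L * u) (hx : IsAdmissiblePoint φ Θ x)
    (h0 : P (history Θ n (fun j => Θ j x)) ≠ 0) :
    1 ≤ L * (φ n (Θ n x) * (1 + Q q Θ n x)) := by
  have hφ := hΘ.phi_pos n hn _ (hΘ.one_le hx hn)
  have hq : 0 ≤ Q q Θ n x := hΘ.q_nonneg n hn _
  have hceil : 1 ≤ ⌈φ n (Θ n x)⌉₊ := Nat.one_le_iff_ne_zero.2 (Nat.ceil_pos.2 hφ).ne'
  have hceil' : (1 : ℝ) ≤ ⌈φ n (Θ n x)⌉₊ := by exact_mod_cast hceil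
  have h1 := hΘ.measureReal_history_inter_ge hF hn hx (Nat.le_ceil (φ n (Θ n x)))
  have h2 : P.real (history Θ n (fun j => Θ j x) ∩ {ω | ⌈φ n (Θ n x)⌉₊ ≤ Θ (n + 1) ω}) =
      P.real (history Θ n (fun j => Θ j x)) := by
    refine measureReal_congr ?_
    filter_upwards [hΘ.ae_isAdmissiblePoint] with ω hω
    refine propext ⟨fun h => h.1, fun h => ⟨h, ?_⟩⟩
    have h3 : Θ n ω = Θ n x := h n hn le_rfl
    have h4 := hω.2 n hn
    rw [h3] at h4
    exact Nat.ceil_le.2 h4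
  have hpos : P.real (history Θ n (fun j => Θ j x)) ≠ 0 :=
    (ENNReal.toReal_pos h0 (measure_ne_top _ _)).ne'
  rw [h2] at h1
  have h3 : F n (delta φ n (Θ n x) ⌈φ n (Θ n x)⌉₊ (Q q Θ n x)) = 1 :=
    mul_left_cancel₀ hpos (by rw [← h1, mul_one])
  have hden : 1 ≤ (⌈φ n (Θ n x)⌉₊ : ℝ) + φ n (Θ n x) * Q q Θ n x := by
    have : 0 ≤ φ n (Θ n x) * Q q Θ n x := by positivity
    linarith
  have h4 := hL (delta φ n (Θ n x) ⌈φ n (Θ n x)⌉₊ (Q q Θ n x)) (by unfold delta; positivity)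
  rw [h3, delta, ← mul_div_assoc, le_div_iff₀ (by linarith), one_mul] at h4
  exact hden.trans h4

lemma measureReal_history_inter_R (hΘ : IsScheme P F φ q Θ) (hF : IsDistributionFunction (F n))
    (hn : 1 ≤ n) {L : ℝ} (hL0 : 0 ≤ L) (hL : ∀ u, 0 < u → F n u ≤ L * u)
    (hx : IsAdmissiblePoint φ Θ x) {t : ℝ} (ht : 1 ≤ t) :
    P.real (history Θ n (fun j => Θ j x)) * F n (t + L)⁻¹ ≤
        P.real (history Θ n (fun j => Θ j x) ∩ {ω | t ≤ R φ q Θ n ω}) ∧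
      P.real (history Θ n (fun j => Θ j x) ∩ {ω | t ≤ R φ q Θ n ω}) ≤
        P.real (history Θ n (fun j => Θ j x)) * F n t⁻¹ := by
  by_cases h0 : P (history Θ n (fun j => Θ j x)) = 0
  · rw [measureReal_def, measureReal_def, measure_mono_null inter_subset_left h0, h0]
    simp
  have hLφ := hΘ.one_le_mul_phi hF hn hL hx h0
  have hφ := hΘ.phi_pos n hn _ (hΘ.one_le hx hn)
  have hq : 0 ≤ Q q Θ n x := hΘ.q_nonneg n hn _
  have hφq : 0 ≤ φ n (Θ n x) * Q q Θ n x := by positivity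
  set g := φ n (Θ n x) * (1 + Q q Θ n x) with hg
  have hgpos : 0 < g := by positivity
  -- On the history `t ≤ R` means `y ≤ Θ_{n+1}`; since `t ≥ 1`, `y` is at least `φ` and the tail
  -- formula applies at `⌈y⌉`.
  set y := t * g - φ n (Θ n x) * Q q Θ n x with hy
  have hy1 : φ n (Θ n x) ≤ y := by
    have h1 : 1 * g ≤ t * g := mul_le_mul_of_nonneg_right ht hgpos.le
    have h2 : g = φ n (Θ n x) + φ n (Θ n x) * Q q Θ n x := by rw [hg]; ring
    linarith
  have hset : history Θ n (fun j => Θ j x) ∩ {ω | t ≤ R φ q Θ n ω} =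
      history Θ n (fun j => Θ j x) ∩ {ω | ⌈y⌉₊ ≤ Θ (n + 1) ω} := by
    ext ω
    refine and_congr_right fun hω => ?_
    have h1 : Θ n ω = Θ n x := hω n hn le_rfl
    have h2 : Q q Θ n ω = Q q Θ n x := congrArg (q n) (mem_history_iff.1 hω)
    change t ≤ R φ q Θ n ω ↔ ⌈y⌉₊ ≤ Θ (n + 1) ω
    rw [Nat.ceil_le, R, h1, h2, ← hg, le_div_iff₀ hgpos, hy, sub_le_iff_le_add]
  rw [hset, hΘ.measureReal_history_inter_ge hF hn hx (hy1.trans (Nat.le_ceil y)), delta, ← hg]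
  have hceil1 := Nat.le_ceil y
  have hceil2 := Nat.ceil_lt_add_one (hφ.le.trans hy1)
  have ht0 : 0 < t := one_pos.trans_le ht
  have hden : 0 < (⌈y⌉₊ : ℝ) + φ n (Θ n x) * Q q Θ n x := by
    have : 0 < t * g := by positivity
    linarith
  refine ⟨mul_le_mul_of_nonneg_left (hF.mono ?_) measureReal_nonneg,
    mul_le_mul_of_nonneg_left (hF.mono ?_) measureReal_nonneg⟩
  -- Rounding up adds less than `1` to `t * g`, and `1 ≤ L * g`, so the denominator of `δ` is at
  -- most `(t + L) * g`.
  · rw [← one_div, div_le_div_iff₀ (by linarith) hden]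
    linarith
  · rw [← one_div, div_le_div_iff₀ hden ht0]
    linarith

end Atom

end IsScheme

/-- A bound on all the atoms of a countable partition extends to its unions. -/
lemma measure_preimage_le_of_singleton {β : Type*} [Countable β] [MeasurableSpace β]
    [MeasurableSingletonClass β] {μ ν : Measure Ω} {f : Ω → β} (hf : Measurable f)
    (h : ∀ y, μ (f ⁻¹' {y}) ≤ ν (f ⁻¹' {y})) (B : Set β) : μ (f ⁻¹' B) ≤ ν (f ⁻¹' B) := by
  rw [← tsum_measure_preimage_singleton (to_countable B) fun y _ =>
    hf (measurableSet_singleton y), ← tsum_measure_preimage_singleton (to_countable B) fun y _ =>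
    hf (measurableSet_singleton y)]
  exact ENNReal.tsum_le_tsum fun y => h y

namespace IsScheme

/-- A past event is a countable union of histories, and the squeeze holds on each with factors that
do not depend on the history. -/
lemma measureReal_inter_R [IsProbabilityMeasure P] (hΘ : IsScheme P F φ q Θ) {n : ℕ} (hF : IsDistributionFunction (F n))
    (hn : 1 ≤ n) {L : ℝ} (hL0 : 0 ≤ L) (hL : ∀ u, 0 < u → F n u ≤ L * u)
    {A : Set Ω} (hA : MeasurableSet[pastSigma Θ n] A) {t : ℝ} (ht : 1 ≤ t) :
    P.real A * F n (t + L)⁻¹ ≤ P.real (A ∩ {ω | t ≤ R φ q Θ n ω}) ∧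
      P.real (A ∩ {ω | t ≤ R φ q Θ n ω}) ≤ P.real A * F n t⁻¹ := by
  obtain ⟨B, -, rfl⟩ := hA
  have hpast : Measurable (past Θ n) :=
    (measurable_pastSigma_past Θ n).mono (hΘ.pastSigma_le n) le_rfl
  set D := {ω | t ≤ R φ q Θ n ω}
  have hD : MeasurableSet D := hΘ.pastSigma_le (n + 1) _
    (measurableSet_le measurable_const (measurable_R φ q Θ hn))
  have hatom : ∀ y, P.real (past Θ n ⁻¹' {y}) * F n (t + L)⁻¹ ≤
      P.real (past Θ n ⁻¹' {y} ∩ D) ∧ P.real (past Θ n ⁻¹' {y} ∩ D) ≤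
        P.real (past Θ n ⁻¹' {y}) * F n t⁻¹ := by
    intro y
    by_cases h0 : P (past Θ n ⁻¹' {y}) = 0
    · rw [measureReal_def, measureReal_def, measure_mono_null inter_subset_left h0, h0]
      simp
    -- Almost every point is admissible, so an atom of positive measure contains an admissible one.
    obtain ⟨x, hxy, hx⟩ : ∃ x ∈ past Θ n ⁻¹' {y}, IsAdmissiblePoint φ Θ x := by
      by_contra! hcon
      exact h0 (measure_mono_null (fun x hx => hcon x hx) (ae_iff.1 hΘ.ae_isAdmissiblePoint))
    have hH : past Θ n ⁻¹' {y} = history Θ n (fun j => Θ j x) := by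
      ext ω
      rw [mem_history_iff, mem_preimage, mem_singleton_iff, ← show past Θ n x = y from hxy]
      rfl
    rw [hH]
    exact hΘ.measureReal_history_inter_R hF hn hL0 hL hx ht
  -- Both inequalities are read as comparisons between a multiple of `P` and `P.restrict D`, so that
  -- atoms can be summed.
  have hscale : ∀ (s : Set Ω) (c : ℝ), 0 ≤ c →
      (ENNReal.ofReal c • P) s = ENNReal.ofReal (P.real s * c) := fun s c hc => by
    rw [Measure.smul_apply, smul_eq_mul, mul_comm, ENNReal.ofReal_mul measureReal_nonneg,
      ofReal_measureReal]
  have hrestrict : ∀ s : Set (Fin n → ℕ),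
      P.restrict D (past Θ n ⁻¹' s) = ENNReal.ofReal (P.real (past Θ n ⁻¹' s ∩ D)) := fun s => by
    rw [Measure.restrict_apply (hpast (MeasurableSet.of_discrete)), ofReal_measureReal]
  constructor
  · have h := measure_preimage_le_of_singleton (μ := ENNReal.ofReal (F n (t + L)⁻¹) • P)
      (ν := P.restrict D) hpast (fun y => by
        rw [hscale _ _ (hF.nonneg _), hrestrict]
        exact ENNReal.ofReal_le_ofReal (hatom y).1) B
    rw [hscale _ _ (hF.nonneg _), hrestrict] at h
    exact (ENNReal.ofReal_le_ofReal_iff measureReal_nonneg).1 h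
  · have h := measure_preimage_le_of_singleton (ν := ENNReal.ofReal (F n t⁻¹) • P)
      (μ := P.restrict D) hpast (fun y => by
        rw [hscale _ _ (hF.nonneg _), hrestrict]
        exact ENNReal.ofReal_le_ofReal (hatom y).2) B
    rw [hscale _ _ (hF.nonneg _), hrestrict] at h
    exact (ENNReal.ofReal_le_ofReal_iff
      (mul_nonneg measureReal_nonneg (hF.nonneg _))).1 h

end IsScheme

end Scheme

end Oppenheim

/-! ### The weak law for Oppenheim expansions -/

theorem mainTheorem2 {Ω : Type*} [MeasurableSpace Ω] (P : Measure Ω) [IsProbabilityMeasure P]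
    (F : ℕ → ℝ → ℝ) (hF : ∀ n, 1 ≤ n → Oppenheim.IsDistributionFunction (F n))
    (α : ℕ → ℝ) (hi : Oppenheim.ConditionI F α) (hii : Oppenheim.ConditionII F α)
    (φ : ℕ → ℕ → ℝ) (q : (n : ℕ) → (Fin n → ℕ) → ℝ) (Θ : ℕ → Ω → ℕ)
    (hΘ : Oppenheim.IsScheme P F φ q Θ)
    (a : ℕ → ℕ → ℝ) (ha : ∀ n k, 1 ≤ k → k ≤ n → 0 < a k n)
    (ρ : ℕ → ℝ) (hρ : Tendsto (fun n : ℕ => ρ n * Real.log n) atTop atTop)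
    (ℓ : ℝ)
    (hlimsup : limsup (fun n : ℕ =>
      (((∑ k ∈ Finset.Icc 1 n, α k * a k n * |Real.log (α k * a k n)|) /
        (ρ n * Real.log n) : ℝ) : EReal)) atTop < ⊤)
    (hlim : Tendsto (fun n : ℕ =>
      (∑ k ∈ Finset.Icc 1 n, α k * a k n * Real.log (α k * a k n)) / (ρ n * Real.log n))
      atTop (𝓝 (-ℓ)))
    (hbdd : ∃ S : ℝ, ∀ n, 1 ≤ n → ∑ k ∈ Finset.Icc 1 n, α k * a k n ≤ S) :
    TendstoInMeasure P
      (fun (n : ℕ) (ω : Ω) =>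
        1 / (ρ n * Real.log n) * ∑ k ∈ Finset.Icc 1 n, a k n * Oppenheim.R φ q Θ k ω)
      atTop (fun _ => ℓ) := by
  obtain ⟨m, hm, hαm⟩ := hi.exists_lower_bound
  obtain ⟨M, hM, hαM⟩ := hi.exists_upper_bound
  obtain ⟨L, hL1, hL⟩ := hi.exists_linear_bound hF
  obtain ⟨K, hK0, hK⟩ := Oppenheim.exists_integral_comp_inv_bound hi hii hF
  obtain ⟨S, hS⟩ := hbdd
  have hL0 : 0 ≤ L := zero_le_one.trans hL1
  have hlog : 0 ≤ Real.log (1 + L) := Real.log_nonneg (by linarith)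
  refine Oppenheim.tendstoInMeasure_weighted_sum (Oppenheim.pastSigma_mono Θ) hΘ.pastSigma_le
    (fun k hk => Oppenheim.measurable_R φ q Θ hk) (fun k hk => hΘ.ae_nonneg_R hk) hL0
    (K := K + 1 + M * Real.log (1 + L)) (by positivity) (fun k hk t ht => ?_) hm
    (fun k hk => ⟨hαm k hk, hαM k hk⟩) (fun k hk c hc => ?_) ha hρ hlim hS
  · rcases le_total 1 t with h1 | h1
    · have h2 := (hΘ.measureReal_inter_R (hF k hk) hk hL0 (hL k hk)
        (@MeasurableSet.univ Ω (Oppenheim.pastSigma Θ k)) h1).2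
      rw [univ_inter, probReal_univ, one_mul] at h2
      exact h2.trans (hL k hk _ (inv_pos.2 ht))
    -- For `t ≤ 1` the tail bound is trivial because `L ≥ 1`.
    · refine measureReal_le_one.trans ?_
      rw [one_le_div ht]
      linarith
  · exact Oppenheim.abs_condExp_min_const_sub_le (hΘ.pastSigma_le k)
      ((Oppenheim.measurable_R φ q Θ hk).mono (hΘ.pastSigma_le _) le_rfl) (hΘ.ae_nonneg_R hk)
      (hF k hk) hL0 (hi.pos k hk).le (hαM k hk) hc (hK k hk)
      (fun A hA t ht => (hΘ.measureReal_inter_R (hF k hk) hk hL0 (hL k hk) hA ht).2)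
      (fun A hA t ht => (hΘ.measureReal_inter_R (hF k hk) hk hL0 (hL k hk) hA ht).1)
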